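/- Let $K$ be a number field, let $B$ be its ring of integers (the integral closure of $\mathbb{Z}$ in $K$), let $a,b,c\in B$, and put $g=aX^2+bXY+cY^2-1$ and $A=B[X,Y]/(g)$. Let $\Gamma$ be the (finite) set of prime ideals $P$ of $B$ with $P\supseteq (2,b)B$ and $P\not\supseteq (a,c)B$. For every $P\in\Gamma$ there are $d,e\in B$ with $d^2\equiv a$ and $e^2\equiv c \pmod P$. For each $P\in\Gamma$ choose such elements $d=d_P$, $e=e_P$ arbitrarily, and put $$F_P=d^2\,g\!\left(\tfrac{-eY-1}{d},Y\right)=(ae^2-bde+cd^2)Y^2+(2ae-bd)Y+(a-d^2)\quad\text{if } a\notin P,$$ $$F_P=e^2\,g\!\left(X,\tfrac{-1}{e}\right)=ae^2X^2-beX+(c-e^2)\quad\text{if } a\in P.$$ Let $P^{-1}\subseteq K$ be the inverse of $P$ as a fractional ideal of $B$, and let $F_PP^{-1}=\{uF_P : u\in P^{-1}\}\subseteq K[X,Y]$. Then $F_PP^{-1}\subseteq B[X,Y]$ for every $P\in\Gamma$, and the singular locus of $A$, that is, the set of prime ideals $M$ of $A$ such that $A_M$ is not a regular local ring, is $V(H)=\{M\in\operatorname{Spec}A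 : M\supseteq H\}$, where $$H=\prod_{P\in\Gamma}(P,F_PP^{-1})A$$ and $(P,F_PP^{-1})A$ is the ideal of $A$ generated by the images of $P$ and of $F_PP^{-1}$ (the empty product is $A$). -/

import Mathlib

open NumberField nonZeroDivisors

namespace Quadric

/-- The set of primes `M` of `R` such that the localization `R_M` is not a regular local ring. -/
def singularLocus (R : Type*) [CommRing R] : Set (PrimeSpectrum R) :=
  {M | ¬ IsRegularLocalRing (Localization.AtPrime M.asIdeal)}

section General

variable {B : Type*} [CommRing B]

/-- The polynomial `g = aX² + bXY + cY² - 1` in `B[X,Y]`; `X` is `X 0` and `Y` is `X 1`. -/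
noncomputable def quadricPoly (a b c : B) : MvPolynomial (Fin 2) B :=
  MvPolynomial.C a * MvPolynomial.X 0 ^ 2
    + MvPolynomial.C b * MvPolynomial.X 0 * MvPolynomial.X 1
    + MvPolynomial.C c * MvPolynomial.X 1 ^ 2 - 1

/-- The ring `A = B[X,Y]/(aX² + bXY + cY² - 1)`. -/
abbrev QuadricRing (a b c : B) : Type _ :=
  MvPolynomial (Fin 2) B ⧸ Ideal.span {quadricPoly a b c}

/-- The set `Γ` of the prime ideals of `B` that contain `(2, b)` and do not contain `(a, c)`. -/
def Gam (a b c : B) : Set (Ideal B) :=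
  {P | P.IsPrime ∧ Ideal.span {2, b} ≤ P ∧ ¬ Ideal.span {a, c} ≤ P}

open Classical in
/-- The polynomial `F_P`. If `a ∉ P` it is `d² g((-eY-1)/d, Y)`, a polynomial in `Y`;
if `a ∈ P` it is `e² g(X, -1/e)`, a polynomial in `X`. -/
noncomputable def FPoly (a b c : B) (P : Ideal B) (d e : B) : MvPolynomial (Fin 2) B :=
  if a ∈ P then
    MvPolynomial.C (a * e ^ 2) * MvPolynomial.X 0 ^ 2
      - MvPolynomial.C (b * e) * MvPolynomial.X 0
      + MvPolynomial.C (c - e ^ 2)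
  else
    MvPolynomial.C (a * e ^ 2 - b * d * e + c * d ^ 2) * MvPolynomial.X 1 ^ 2
      + MvPolynomial.C (2 * a * e - b * d) * MvPolynomial.X 1
      + MvPolynomial.C (a - d ^ 2)

end General

section RingOfIntegers

variable {K : Type*} [Field K] [NumberField K]

theorem finite_Gam (a b c : 𝓞 K) : (Gam a b c).Finite := by
  have h2 : (Ideal.span {(2 : 𝓞 K)} : Ideal (𝓞 K)) ≠ 0 := by
    simp
  refine ((Ideal.finite_factors h2).image (fun v => v.asIdeal)).subset ?_
  rintro P ⟨hP, h, -⟩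
  have hm : (2 : 𝓞 K) ∈ P := h (Ideal.subset_span (by simp))
  have hne : P ≠ ⊥ := by
    rintro rfl
    simp at hm
  refine ⟨⟨P, hP, hne⟩, ?_, rfl⟩
  simpa [Ideal.dvd_span_singleton] using hm

/-- The set `F P⁻¹ = {u F | u ∈ P⁻¹}`, a subset of `K[X,Y]`, where `P⁻¹ ⊆ K` is the inverse of `P`
as a fractional ideal. -/
def mulInv (F : MvPolynomial (Fin 2) (𝓞 K)) (P : Ideal (𝓞 K)) : Set (MvPolynomial (Fin 2) K) :=
  {h | ∃ u ∈ (P : FractionalIdeal (𝓞 K)⁰ K)⁻¹,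
    h = MvPolynomial.C u * MvPolynomial.map (algebraMap (𝓞 K) K) F}

/-- The ideal `(P, F P⁻¹)A` of `A`: it is generated by the images of the elements of `P` and of the
polynomials over `B` that lie in `F P⁻¹`. -/
noncomputable def primeFactor (a b c : 𝓞 K) (F : MvPolynomial (Fin 2) (𝓞 K)) (P : Ideal (𝓞 K)) :
    Ideal (QuadricRing a b c) :=
  P.map (algebraMap (𝓞 K) (QuadricRing a b c)) ⊔
    (Ideal.span (MvPolynomial.map (algebraMap (𝓞 K) K) ⁻¹' mulInv F P)).map
      (Ideal.Quotient.mk (Ideal.span {quadricPoly a b c}))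

/-- The ideal `H`, the product over `P ∈ Γ` of the ideals `(P, F_P P⁻¹)A`, where `F_P` is formed with
the elements `d P` and `e P`. -/
noncomputable def HIdeal (a b c : 𝓞 K) (d e : Ideal (𝓞 K) → 𝓞 K) : Ideal (QuadricRing a b c) :=
  ∏ P ∈ (finite_Gam a b c).toFinset, primeFactor a b c (FPoly a b c P (d P) (e P)) P

end RingOfIntegers

end Quadric

/-! Let `M` be a prime of `A` with preimage `p` in the regular domain `S = B[X,Y]`. Then `A_M =
S_p/(g)`, which is regular iff `g ∉ p²S_p` (`IsRegularRing.isRegularLocalRing_quotient_iff`);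
membership in `p²S_p` is written `∃ t ∉ p, t * g ∈ p ^ 2`.

If `g ∈ p²S_p`, both partial derivatives of `g` lie in `p`, and this forces `P = p ∩ B` into `Γ`
(`comap_C_mem_Gam`). Over such a `P`, `g` is congruent to the square of `l = dX + eY + 1`, so `l ∈
p`. Expanding `g` in powers of `l`, the linear term has its coefficient in `(2,b)` and the constant
term is `F_P`, up to the unit `d²` (or `e²`, with `eY + 1` for `l`). So `g` may be replaced by `F_P`
modulo `p²S_p` (`exists_mul_quadricPoly_sub_FPoly_mem_sq`).

Finally `F_P` has coefficients in `P`, and `P` is locally generated by some `π ∉ p²S_p`; dividing by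
`π` gives `F_P ∈ p²S_p` iff `F_P P⁻¹ ⊆ p` (`exists_mul_mem_sq_iff`). -/

/-! ### Regularity of hypersurface quotients -/

-- By Nakayama the minimal number of generators is the dimension of the cotangent space, and length
-- is unchanged along surjections of scalars. Allowing a general `R` lets the cotangent spaces of a
-- ring and of its quotient be compared over one ring.
open IsLocalRing in
theorem IsLocalRing.length_cotangent_eq_spanFinrank {R T : Type*} [CommRing R] [CommRing T]
    [IsLocalRing T] [IsNoetherianRing T] [Algebra R T]
    (h : Function.Surjective (algebraMap R T)) :
    Module.length R (maximalIdeal T).Cotangent = (maximalIdeal T).spanFinrank := by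
  rw [Module.length_eq_of_surjective h,
    Module.length_eq_of_surjective (S := T) (R := ResidueField T) (M := (maximalIdeal T).Cotangent)
      residue_surjective, spanFinrank_maximalIdeal_eq_finrank_cotangentSpace]
  exact Module.length_eq_finrank (ResidueField T) (CotangentSpace T)

open IsLocalRing in
/-- The quotient of a regular local ring by a regular element `f` is regular iff `f ∉ 𝔪²`. -/
theorem IsRegularLocalRing.quotient_span_singleton_iff {R : Type*} [CommRing R]
    [IsRegularLocalRing R] {f : R} (hf : f ∈ R⁰) (hm : f ∈ maximalIdeal R) :
    IsRegularLocalRing (R ⧸ Ideal.span {f}) ↔ f ∉ maximalIdeal R ^ 2 := by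
  have hle : Ideal.span {f} ≤ maximalIdeal R := by simpa [Ideal.span_le] using hm
  have : Nontrivial (R ⧸ Ideal.span {f}) :=
    Ideal.Quotient.nontrivial_iff.mpr fun h ↦
      (maximalIdeal.isMaximal R).ne_top (top_le_iff.mp (h ▸ hle))
  have hsurj : Function.Surjective (algebraMap R (R ⧸ Ideal.span {f})) :=
    Ideal.Quotient.mk_surjective
  have : IsLocalRing (R ⧸ Ideal.span {f}) := .of_surjective' _ hsurj
  have hloc : IsLocalHom (algebraMap R (R ⧸ Ideal.span {f})) := hsurj.isLocalHom _
  have hker : RingHom.ker (algebraMap R (R ⧸ Ideal.span {f})) = Ideal.span {f} :=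
    Ideal.mk_ker
  have hcomap : (maximalIdeal (R ⧸ Ideal.span {f})).comap (algebraMap R (R ⧸ Ideal.span {f})) =
      RingHom.ker (algebraMap R (R ⧸ Ideal.span {f})) ⊔ maximalIdeal R := by
    rw [hker, sup_eq_right.mpr hle, maximalIdeal_comap]
  have hφs := Ideal.mapCotangent_surjective_of_comap_eq hsurj hcomap
  have hφk := Ideal.mapCotangent_ker_of_surjective hsurj hcomap
  set φ := Ideal.mapCotangent (maximalIdeal R) (maximalIdeal (R ⧸ Ideal.span {f}))
    (Algebra.ofId R (R ⧸ Ideal.span {f})) (le_of_le_of_eq le_sup_right hcomap.symm)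
  -- The kernel of the map of cotangent spaces is spanned by the class of `f`, so it vanishes iff `f
  -- ∈ 𝔪²`. The dimension drops by exactly one in either case.
  have hadd := Module.length_eq_add_of_exact (LinearMap.ker φ).subtype φ
    (Submodule.subtype_injective _) hφs (LinearMap.exact_subtype_ker_map φ)
  rw [length_cotangent_eq_spanFinrank hsurj,
    length_cotangent_eq_spanFinrank (R := R) (T := R) Function.surjective_id] at hadd
  have hdim := ringKrullDim_quotient_span_singleton_succ_eq_ringKrullDim_of_mem_nonZeroDivisors
    hf hm
  rw [← (isRegularLocalRing_iff R).mp ‹_›] at hdim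
  constructor
  · intro hreg hf2
    rw [← (isRegularLocalRing_iff _).mp hreg] at hdim
    have hbot : LinearMap.ker φ = ⊥ := by
      rw [hφk, hker, inf_eq_left.mpr hle, eq_bot_iff]
      rintro _ ⟨x, hx, rfl⟩
      rw [Submodule.mem_bot, Ideal.toCotangent_eq_zero]
      exact (Ideal.span_singleton_le_iff_mem _).mpr hf2 hx
    rw [hbot, Module.length_bot, zero_add] at hadd
    have h1 := ENat.natCast_inj.mp hadd
    have h2 : (maximalIdeal (R ⧸ Ideal.span {f})).spanFinrank + 1 =
      (maximalIdeal R).spanFinrank := by exact_mod_cast hdim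
    omega
  · intro hf2
    apply IsRegularLocalRing.of_spanFinrank_maximalIdeal_le
    have hpos : Nontrivial (LinearMap.ker φ) := by
      refine Submodule.nontrivial_iff_ne_bot.mpr fun hbot ↦ hf2 ?_
      have : (maximalIdeal R).toCotangent ⟨f, hm⟩ ∈ LinearMap.ker φ := by
        rw [hφk, hker]
        exact ⟨⟨f, hm⟩, ⟨Ideal.mem_span_singleton_self f, hm⟩, rfl⟩
      rwa [hbot, Submodule.mem_bot, Ideal.toCotangent_eq_zero] at this
    have hpos' := Order.one_le_iff_pos.mpr (Module.length_pos (R := R) (M := LinearMap.ker φ))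
    have h1 : (((maximalIdeal (R ⧸ Ideal.span {f})).spanFinrank + 1 : ℕ) : ℕ∞) ≤
        (maximalIdeal R).spanFinrank := by
      rw [hadd, Nat.cast_add, Nat.cast_one, add_comm]
      gcongr
    have h2 : (maximalIdeal (R ⧸ Ideal.span {f})).spanFinrank + 1 ≤
        (maximalIdeal R).spanFinrank := by exact_mod_cast h1
    have h3 : ((maximalIdeal (R ⧸ Ideal.span {f})).spanFinrank : WithBot ℕ∞) + 1 ≤
        ringKrullDim (R ⧸ Ideal.span {f}) + 1 := by
      rw [hdim]; exact_mod_cast h2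
    exact ENat.WithBot.add_le_add_one_right_iff.mp h3

/-- Localization commutes with quotients: `(S ⧸ I)_M ≃ S_p ⧸ I S_p` for `p` the preimage of `M`. -/
theorem Ideal.isLocalization_atPrime_quotient {S : Type*} [CommRing S] (I : Ideal S)
    (M : Ideal (S ⧸ I)) [M.IsPrime] (p : Ideal S) [p.IsPrime]
    (hp : M.comap (Ideal.Quotient.mk I) = p) :
    Nonempty (Localization.AtPrime M ≃+*
      Localization.AtPrime p ⧸ I.map (algebraMap S (Localization.AtPrime p))) := by
  have hI : I = RingHom.ker (Ideal.Quotient.mk I) := Ideal.mk_ker.symm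
  have hmap : p.primeCompl.map (Ideal.Quotient.mk I) = M.primeCompl := by
    ext x
    obtain ⟨x, rfl⟩ := Ideal.Quotient.mk_surjective x
    simp only [Submonoid.mem_map, Ideal.mem_primeCompl_iff, ← hp, Ideal.mem_comap]
    exact ⟨fun ⟨y, hy, hyx⟩ ↦ hyx ▸ hy, fun hx ↦ ⟨x, hx, rfl⟩⟩
  have hloc := IsLocalization.of_surjective p.primeCompl (Localization.AtPrime p)
    (S' := Localization.AtPrime p ⧸ I.map (algebraMap S (Localization.AtPrime p)))
    (Ideal.Quotient.mk I) Ideal.Quotient.mk_surjective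
    (Ideal.Quotient.mk (I.map (algebraMap S (Localization.AtPrime p))))
    Ideal.Quotient.mk_surjective rfl (by rw [Ideal.mk_ker, Ideal.mk_ker])
  rw [hmap] at hloc
  exact ⟨(IsLocalization.algEquiv M.primeCompl (Localization.AtPrime M)
    (Localization.AtPrime p ⧸ I.map (algebraMap S (Localization.AtPrime p)))).toRingEquiv⟩

theorem IsLocalization.AtPrime.algebraMap_mem_maximalIdeal_sq_iff {S : Type*} [CommRing S]
    (p : Ideal S) [p.IsPrime] (f : S) :
    algebraMap S (Localization.AtPrime p) f ∈
      IsLocalRing.maximalIdeal (Localization.AtPrime p) ^ 2 ↔ ∃ t ∉ p, t * f ∈ p ^ 2 := by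
  rw [← Localization.AtPrime.map_eq_maximalIdeal, ← Ideal.map_pow,
    IsLocalization.algebraMap_mem_map_algebraMap_iff p.primeCompl]
  simp [Ideal.mem_primeCompl_iff]

/-- If the ideal `I` of a regular domain is locally at `p` generated by a nonzero `f ∈ p`, then
`(S ⧸ I)_p` is regular iff `f ∉ p² S_p`. -/
theorem IsRegularRing.isRegularLocalRing_quotient_iff {S : Type*} [CommRing S] [IsDomain S]
    [IsRegularRing S] (I : Ideal S) (M : Ideal (S ⧸ I)) [M.IsPrime] (p : Ideal S) [p.IsPrime]
    (hp : M.comap (Ideal.Quotient.mk I) = p) {f : S} (hf : f ≠ 0) (hfp : f ∈ p)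
    (hI : I.map (algebraMap S (Localization.AtPrime p)) =
      Ideal.span {algebraMap S (Localization.AtPrime p) f}) :
    IsRegularLocalRing (Localization.AtPrime M) ↔ ∀ t ∉ p, t * f ∉ p ^ 2 := by
  obtain ⟨e⟩ := Ideal.isLocalization_atPrime_quotient I M p hp
  have hmem : algebraMap S (Localization.AtPrime p) f ∈
      IsLocalRing.maximalIdeal (Localization.AtPrime p) :=
    (IsLocalization.AtPrime.to_map_mem_maximal_iff _ p f).mpr hfp
  have hne : algebraMap S (Localization.AtPrime p) f ≠ 0 := by
    rwa [Ne, FaithfulSMul.algebraMap_eq_zero_iff]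
  have key := IsRegularLocalRing.quotient_span_singleton_iff (mem_nonZeroDivisors_of_ne_zero hne)
    hmem
  rw [← hI, IsLocalization.AtPrime.algebraMap_mem_maximalIdeal_sq_iff] at key
  rw [show IsRegularLocalRing (Localization.AtPrime M) ↔ IsRegularLocalRing
    (Localization.AtPrime p ⧸ I.map (algebraMap S (Localization.AtPrime p))) from
      ⟨fun _ ↦ .of_ringEquiv e, fun _ ↦ .of_ringEquiv e.symm⟩, key]
  push Not
  rfl

/-! ### Primes of the polynomial ring above a prime of the base -/

/-- A maximal ideal `P` of a Dedekind domain `B` contains an element that lies outside `p² B[X]_p`,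
for every prime `p` of the polynomial ring above `P`. -/
theorem MvPolynomial.exists_mem_forall_mul_C_notMem_sq {B σ : Type*} [CommRing B]
    [IsDedekindDomain B] [Finite σ] (P : Ideal B) [P.IsMaximal] (hP : P ≠ ⊥)
    (p : Ideal (MvPolynomial σ B)) [p.IsPrime] (hp : P.map MvPolynomial.C ≤ p) :
    ∃ π ∈ P, ∀ t ∉ p, t * MvPolynomial.C π ∉ p ^ 2 := by
  have hPp : ∀ x, MvPolynomial.C x ∈ p ↔ x ∈ P := by
    have : P = p.comap MvPolynomial.C :=
      Ideal.IsMaximal.eq_of_le ‹_› (Ideal.IsPrime.ne_top inferInstance)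
        (Ideal.map_le_iff_le_comap.mp hp)
    exact fun x ↦ by rw [this, Ideal.mem_comap]
  obtain ⟨π, hπ, hπ2⟩ : ∃ π ∈ P, π ∉ P ^ 2 := by
    have := Ideal.pow_right_strictAnti P hP (Ideal.IsPrime.ne_top inferInstance) one_lt_two
    simp only [pow_one] at this
    exact SetLike.exists_of_lt this
  -- `π` generates `P` locally: `(π) = PQ` with `Q ⊄ P`, and any `s ∈ Q \ P` serves for every `x`.
  have hgen : ∀ x ∈ P, ∃ s ∉ P, ∃ y, s * x = π * y := by
    obtain ⟨Q, hQ⟩ := Ideal.dvd_span_singleton.mpr hπ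
    have hQP : ¬ Q ≤ P := fun h ↦ hπ2 <| by
      rw [sq, ← Ideal.span_singleton_le_iff_mem, hQ]
      exact Ideal.mul_mono_right h
    obtain ⟨s, hs, hsP⟩ := SetLike.not_le_iff_exists.mp hQP
    intro x hx
    have : s * x ∈ Ideal.span {π} := by
      rw [hQ, mul_comm s]
      exact Ideal.mul_mem_mul hx hs
    obtain ⟨y, hy⟩ := Ideal.mem_span_singleton.mp this
    exact ⟨s, hsP, y, hy⟩
  refine ⟨π, hπ, ?_⟩
  let := Ideal.Quotient.field P
  have : IsRegularRing (MvPolynomial σ B ⧸ P.map MvPolynomial.C) :=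
    IsRegularRing.of_ringEquiv (MvPolynomial.quotientEquivQuotientMvPolynomial P).toRingEquiv
  have hcomap : (p.map (Ideal.Quotient.mk (P.map MvPolynomial.C))).comap
      (Ideal.Quotient.mk (P.map MvPolynomial.C)) = p := by
    rw [Ideal.comap_map_of_surjective' _ Ideal.Quotient.mk_surjective, Ideal.mk_ker, sup_eq_left]
    exact hp
  have : (p.map (Ideal.Quotient.mk (P.map MvPolynomial.C))).IsPrime :=
    Ideal.map_isPrime_of_surjective Ideal.Quotient.mk_surjective (by rwa [Ideal.mk_ker])
  -- The regularity criterion is read backwards: the quotient is a polynomial ring over the field `B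
  -- ⧸ P`, hence regular, so the local generator `π` is outside `p²`.
  refine (IsRegularRing.isRegularLocalRing_quotient_iff (P.map MvPolynomial.C) _ p hcomap
    (f := MvPolynomial.C π) ?_ ((hPp π).mpr hπ) ?_).mp inferInstance
  · rw [Ne, MvPolynomial.C_eq_zero]
    rintro rfl
    exact hπ2 (zero_mem _)
  · refine le_antisymm ?_ ?_
    · rw [Ideal.map_map, Ideal.map_le_iff_le_comap]
      intro x hx
      obtain ⟨s, hs, y, hy⟩ := hgen x hx
      have hu : IsUnit (algebraMap (MvPolynomial σ B) (Localization.AtPrime p)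
          (MvPolynomial.C s)) :=
        IsLocalization.map_units (Localization.AtPrime p)
          (⟨MvPolynomial.C s, (hPp s).not.mpr hs⟩ : p.primeCompl)
      rw [Ideal.mem_comap, ← Ideal.unit_mul_mem_iff_mem _ hu, RingHom.comp_apply, ← map_mul,
        ← map_mul, hy, map_mul, map_mul]
      exact Ideal.mul_mem_right _ _ (Ideal.mem_span_singleton_self _)
    · rw [Ideal.span_singleton_le_iff_mem]
      exact Ideal.mem_map_of_mem _ (Ideal.mem_map_of_mem _ hπ)

theorem Derivation.mem_of_mem_sq {R A : Type*} [CommRing R] [CommRing A] [Algebra R A]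
    (D : Derivation R A A) {I : Ideal A} {x : A} (hx : x ∈ I ^ 2) : D x ∈ I := by
  rw [sq] at hx
  refine Submodule.mul_induction_on hx (fun m hm n hn ↦ ?_) fun y z hy hz ↦ ?_
  · rw [D.leibniz]
    exact add_mem (I.mul_mem_right _ hm) (I.mul_mem_right _ hn)
  · rw [map_add]
    exact add_mem hy hz

namespace Quadric

/-! ### The singular primes and the reduction of `g` to `F_P` -/

section General

open MvPolynomial

variable {B : Type*} [CommRing B]

theorem quadricPoly_ne_zero [Nontrivial B] (a b c : B) : quadricPoly a b c ≠ 0 := by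
  intro h
  have := congrArg (MvPolynomial.aeval (fun _ ↦ (0 : B))) h
  simp [quadricPoly] at this

theorem pderiv_zero_quadricPoly (a b c : B) :
    pderiv 0 (quadricPoly a b c) = 2 * C a * X 0 + C b * X 1 := by
  simp [quadricPoly, pderiv_X]
  ring

theorem pderiv_one_quadricPoly (a b c : B) :
    pderiv 1 (quadricPoly a b c) = C b * X 0 + 2 * C c * X 1 := by
  simp [quadricPoly, pderiv_X]
  ring

/-- If `g ∈ p` is a singular point, then `p` lies above a prime in `Γ`. -/
theorem comap_C_mem_Gam {a b c : B} {p : Ideal (MvPolynomial (Fin 2) B)} [p.IsPrime]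
    (hg : quadricPoly a b c ∈ p) {t : MvPolynomial (Fin 2) B} (ht : t ∉ p)
    (h : t * quadricPoly a b c ∈ p ^ 2) : p.comap C ∈ Gam a b c := by
  have hp : p.IsPrime := inferInstance
  have hD (i : Fin 2) : pderiv i (quadricPoly a b c) ∈ p := by
    have h1 := (pderiv i).mem_of_mem_sq h
    rw [Derivation.leibniz, smul_eq_mul, smul_eq_mul] at h1
    have h2 : t * pderiv i (quadricPoly a b c) ∈ p :=
      (p.add_mem_iff_left (p.mul_mem_right _ hg)).mp h1
    exact (hp.mem_or_mem h2).resolve_left ht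
  have h0 := hD 0
  have h1 := hD 1
  rw [pderiv_zero_quadricPoly] at h0
  rw [pderiv_one_quadricPoly] at h1
  have hone : (1 : MvPolynomial (Fin 2) B) ∉ p := (Ideal.ne_top_iff_one p).mp hp.ne_top
  -- Euler's relation: `X g_X + Y g_Y - 2g = 2`.
  have h2 : C (2 : B) ∈ p := by
    have := sub_mem (add_mem (p.mul_mem_left (X 0) h0) (p.mul_mem_left (X 1) h1))
      (p.mul_mem_left 2 hg)
    convert this using 1
    simp only [quadricPoly, map_ofNat]
    ring
  -- Modulo 2 the derivatives are `bY` and `bX`; if `b ∉ p`, then `X, Y ∈ p` and `g ≡ -1`.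
  have hb : C b ∈ p := by
    by_contra hb
    have hY : X 1 ∈ p := by
      refine (hp.mem_or_mem (?_ : C b * X 1 ∈ p)).resolve_left hb
      refine (p.add_mem_iff_right ?_).mp h0
      rw [mul_assoc]
      exact p.mul_mem_right _ (by rwa [map_ofNat] at h2)
    have hX : X 0 ∈ p := by
      refine (hp.mem_or_mem (?_ : C b * X 0 ∈ p)).resolve_left hb
      exact (p.add_mem_iff_left (p.mul_mem_left _ hY)).mp h1
    refine hone ?_
    have := sub_mem (add_mem (p.mul_mem_left (C a * X 0 + C b * X 1) hX)
      (p.mul_mem_left (C c * X 1) hY)) hg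
    convert this using 1
    simp only [quadricPoly]
    ring
  refine ⟨inferInstance, ?_, fun hac ↦ hone ?_⟩
  · rw [Ideal.span_le]
    rintro x (rfl | rfl)
    exacts [h2, hb]
  · have ha : C a ∈ p := hac (Ideal.subset_span (by simp))
    have hc : C c ∈ p := hac (Ideal.subset_span (by simp))
    have := sub_mem (add_mem (add_mem (p.mul_mem_left (X 0 ^ 2) ha)
      (p.mul_mem_left (X 0 * X 1) hb)) (p.mul_mem_left (X 1 ^ 2) hc)) hg
    convert this using 1
    simp only [quadricPoly]
    ring

theorem two_mem_of_mem_Gam {a b c : B} {P : Ideal B} (hP : P ∈ Gam a b c) : (2 : B) ∈ P :=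
  hP.2.1 (Ideal.subset_span (by simp))

theorem mem_of_mem_Gam {a b c : B} {P : Ideal B} (hP : P ∈ Gam a b c) : b ∈ P :=
  hP.2.1 (Ideal.subset_span (by simp))

theorem FPoly_mem_map_C {a b c d e : B} {P : Ideal B} (hP : P ∈ Gam a b c) (hd : d ^ 2 - a ∈ P)
    (he : e ^ 2 - c ∈ P) : FPoly a b c P d e ∈ P.map (C (σ := Fin 2)) := by
  have h2 := two_mem_of_mem_Gam hP
  have hb := mem_of_mem_Gam hP
  have hC {x : B} (hx : x ∈ P) : C (σ := Fin 2) x ∈ P.map C := Ideal.mem_map_of_mem _ hx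
  unfold FPoly
  split_ifs with ha
  · refine add_mem (sub_mem (Ideal.mul_mem_right _ _ (hC (P.mul_mem_right _ ha)))
      (Ideal.mul_mem_right _ _ (hC (P.mul_mem_right _ hb)))) (hC ?_)
    rw [← neg_mem_iff]
    convert he using 1
    ring
  · refine add_mem (add_mem (Ideal.mul_mem_right _ _ (hC ?_))
      (Ideal.mul_mem_right _ _ (hC ?_))) (hC ?_)
    -- Modulo `P` the leading coefficient is `ae² + cd² ≡ 2d²e² ≡ 0`.
    · have := sub_mem (P.mul_mem_left (d ^ 2 * e ^ 2) h2) (add_mem (add_mem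
        (P.mul_mem_left (e ^ 2) hd) (P.mul_mem_left (d ^ 2) he)) (P.mul_mem_left (d * e) hb))
      convert this using 1
      ring
    · have := sub_mem (P.mul_mem_left (a * e) h2) (P.mul_mem_left d hb)
      convert this using 1
      ring
    · rw [← neg_mem_iff]
      convert hd using 1
      ring

/-- If `g ∈ p` and `p` lies above `P ∈ Γ`, then `g` and `F_P` agree modulo `p²` up to a factor
outside `p`. -/
theorem exists_mul_quadricPoly_sub_FPoly_mem_sq {a b c d e : B} {P : Ideal B}
    (hP : P ∈ Gam a b c) (hd : d ^ 2 - a ∈ P) (he : e ^ 2 - c ∈ P)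
    {p : Ideal (MvPolynomial (Fin 2) B)} [p.IsPrime] (hp : p.comap C = P)
    (hg : quadricPoly a b c ∈ p) :
    ∃ u ∉ p, u * quadricPoly a b c - FPoly a b c P d e ∈ p ^ 2 := by
  have hPp (x : B) : C x ∈ p ↔ x ∈ P := by rw [← hp, Ideal.mem_comap]
  have hpp : p.IsPrime := inferInstance
  have hPP : P.IsPrime := hP.1
  have h2 : (2 : MvPolynomial (Fin 2) B) ∈ p := by
    simpa only [map_ofNat] using (hPp 2).mpr (two_mem_of_mem_Gam hP)
  have hb := (hPp b).mpr (mem_of_mem_Gam hP)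
  have hd' := (hPp _).mpr hd
  have he' := (hPp _).mpr he
  -- Modulo `P`, where `2 = b = 0`, `g ≡ d²X² + e²Y² + 1 ≡ (dX + eY + 1)²`.
  have hl : C d * X 0 + C e * X 1 + 1 ∈ p := by
    refine hpp.mem_of_pow_mem 2 ?_
    have := add_mem (add_mem hg (p.mul_mem_left (C d * C e * X 0 * X 1 + C d * X 0 + C e * X 1 + 1)
      h2)) (sub_mem (add_mem (p.mul_mem_left (X 0 ^ 2) hd') (p.mul_mem_left (X 1 ^ 2) he'))
        (p.mul_mem_left (X 0 * X 1) hb))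
    convert this using 1
    simp only [quadricPoly, map_sub, map_pow]
    ring
  unfold FPoly
  split_ifs with ha
  · have hdp : C d ∈ p := by
      refine hpp.mem_of_pow_mem 2 ?_
      have := add_mem hd' ((hPp a).mpr ha)
      convert this using 1
      simp
    have hep : C e ∉ p := fun h ↦ hP.2.2 <| by
      rw [Ideal.span_le]
      rintro x (rfl | rfl)
      · exact ha
      · have := sub_mem (P.mul_mem_left e ((hPp e).mp h)) he
        rwa [sq, sub_sub_cancel] at this
    have hl' : C e * X 1 + 1 ∈ p := by
      have := sub_mem hl (p.mul_mem_left (X 0) hdp)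
      convert this using 1
      ring
    refine ⟨C e ^ 2, fun h ↦ hep (hpp.mem_of_pow_mem 2 h), ?_⟩
    rw [sq p]
    -- With `l' = eY + 1`: `e²g - F_P = eX·b·l' + c·l'² - c·2·l'`.
    have := sub_mem (add_mem (Ideal.mul_mem_left _ (C e * X 0) (Ideal.mul_mem_mul hb hl'))
      (Ideal.mul_mem_left _ (C c) (Ideal.mul_mem_mul hl' hl')))
      (Ideal.mul_mem_left _ (C c) (Ideal.mul_mem_mul h2 hl'))
    convert this using 1
    simp only [quadricPoly, map_sub, map_pow, map_mul]
    ring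
  · have hdp : C d ∉ p := fun h ↦ ha <| by
      have := sub_mem (P.mul_mem_left d ((hPp d).mp h)) hd
      convert this using 1
      ring
    refine ⟨C d ^ 2, fun h ↦ hdp (hpp.mem_of_pow_mem 2 h), ?_⟩
    rw [sq p]
    -- Substituting `dX = l - (eY + 1)`: `d²g - F_P = a·l² - a(eY + 1)·2·l + dY·b·l`.
    have := add_mem (sub_mem (Ideal.mul_mem_left _ (C a) (Ideal.mul_mem_mul hl hl))
      (Ideal.mul_mem_left _ (C a * (C e * X 1 + 1)) (Ideal.mul_mem_mul h2 hl)))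
      (Ideal.mul_mem_left _ (C d * X 1) (Ideal.mul_mem_mul hb hl))
    convert this using 1
    simp only [quadricPoly, map_sub, map_add, map_pow, map_mul, map_ofNat]
    ring

end General

/-! ### Division by `P` and the singular locus -/

section RingOfIntegers

open MvPolynomial

variable {K : Type*} [Field K] [NumberField K]

theorem ne_bot_of_mem_Gam {a b c : 𝓞 K} {P : Ideal (𝓞 K)} (hP : P ∈ Gam a b c) : P ≠ ⊥ := by
  rintro rfl
  simpa using two_mem_of_mem_Gam hP

/-- Every element of the finite field `B ⧸ P` of characteristic two is a square. -/
theorem exists_sq_sub_mem {P : Ideal (𝓞 K)} [P.IsPrime] (hP : P ≠ ⊥) (h2 : (2 : 𝓞 K) ∈ P)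
    (x : 𝓞 K) : ∃ y, y ^ 2 - x ∈ P := by
  have : P.IsMaximal := Ideal.IsPrime.isMaximal inferInstance hP
  let := Ideal.Quotient.field P
  have := Ideal.finiteQuotientOfFreeOfNeBot P hP
  have hchar : CharP (𝓞 K ⧸ P) 2 := by
    refine CharTwo.of_one_ne_zero_of_two_eq_zero one_ne_zero ?_
    rw [← map_ofNat (Ideal.Quotient.mk P) 2]
    exact Ideal.Quotient.eq_zero_iff_mem.mpr h2
  obtain ⟨z, hz⟩ := FiniteField.isSquare_of_char_two (ringChar.eq (𝓞 K ⧸ P) 2)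
    (Ideal.Quotient.mk P x)
  obtain ⟨y, rfl⟩ := Ideal.Quotient.mk_surjective z
  refine ⟨y, Ideal.Quotient.eq.mp ?_⟩
  rw [map_pow, hz, sq]

theorem exists_algebraMap_eq_mul {P : Ideal (𝓞 K)} (hP : P ≠ ⊥) {u : K}
    (hu : u ∈ (P : FractionalIdeal (𝓞 K)⁰ K)⁻¹) {x : 𝓞 K} (hx : x ∈ P) :
    ∃ r, algebraMap (𝓞 K) K r = u * algebraMap (𝓞 K) K x := by
  rw [FractionalIdeal.mem_inv_iff (FractionalIdeal.coeIdeal_ne_zero.mpr hP)] at hu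
  exact (FractionalIdeal.mem_one_iff _).mp
    (hu _ ((FractionalIdeal.mem_coeIdeal _).mpr ⟨x, hx, rfl⟩))

theorem mulInv_subset_range {P : Ideal (𝓞 K)} (hP : P ≠ ⊥) {F : MvPolynomial (Fin 2) (𝓞 K)}
    (hF : F ∈ P.map (C (σ := Fin 2))) :
    mulInv F P ⊆ Set.range (MvPolynomial.map (σ := Fin 2) (algebraMap (𝓞 K) K)) := by
  rintro _ ⟨u, hu, rfl⟩
  rw [mem_range_map_iff_coeffs_subset]
  intro y hy
  obtain ⟨m, -, rfl⟩ := mem_coeffs_iff.mp hy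
  rw [coeff_C_mul, coeff_map]
  exact exists_algebraMap_eq_mul hP hu (mem_map_C_iff.mp hF m)

/-- Locally `F = πG` with `π` a generator of `P` outside `p²`, so `F ∈ p²` exactly when `G ∈ p`;
using all of `P⁻¹` avoids choosing a generator. -/
theorem exists_mul_mem_sq_iff {P : Ideal (𝓞 K)} [P.IsPrime] (hP : P ≠ ⊥)
    {F : MvPolynomial (Fin 2) (𝓞 K)} (hF : F ∈ P.map (C (σ := Fin 2)))
    {p : Ideal (MvPolynomial (Fin 2) (𝓞 K))} [p.IsPrime] (hp : P.map C ≤ p) :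
    (∃ t ∉ p, t * F ∈ p ^ 2) ↔ MvPolynomial.map (algebraMap (𝓞 K) K) ⁻¹' mulInv F P ⊆ p := by
  have hpp : p.IsPrime := inferInstance
  constructor
  · rintro ⟨t, ht, htF⟩ G ⟨u, hu, hG⟩
    by_contra hGp
    have : P.IsMaximal := Ideal.IsPrime.isMaximal inferInstance hP
    obtain ⟨π, hπ, hπp⟩ := exists_mem_forall_mul_C_notMem_sq P hP p hp
    obtain ⟨r, hr⟩ := exists_algebraMap_eq_mul hP hu hπ
    -- Here `G = uF` and `r = uπ ∈ B`. If `G ∉ p`, this relation would put `π` into `p²` locally.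
    have heq : G * C π = C r * F := by
      apply map_injective (σ := Fin 2) (algebraMap (𝓞 K) K) (FaithfulSMul.algebraMap_injective _ _)
      rw [map_mul, map_mul, hG, map_C, map_C, hr, map_mul]
      ring
    refine hπp (t * G) (fun h ↦ (hpp.mem_or_mem h).elim ht hGp) ?_
    rw [mul_assoc, heq, mul_left_comm]
    exact Ideal.mul_mem_left _ _ htF
  · intro h
    refine ⟨1, (Ideal.ne_top_iff_one p).mp hpp.ne_top, ?_⟩
    -- Since `1 ∈ P P⁻¹`, `F` is a sum of products `x·(uF)` with `x ∈ P ⊆ p` and `uF ∈ p`.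
    have key : ∀ r ∈ (P : FractionalIdeal (𝓞 K)⁰ K) * (P : FractionalIdeal (𝓞 K)⁰ K)⁻¹,
        ∃ G ∈ p ^ 2, MvPolynomial.map (algebraMap (𝓞 K) K) G =
          C r * MvPolynomial.map (algebraMap (𝓞 K) K) F := by
      intro r hr
      refine FractionalIdeal.mul_induction_on hr (fun i hi j hj ↦ ?_) ?_
      · obtain ⟨x, hx, rfl⟩ := (FractionalIdeal.mem_coeIdeal _).mp hi
        have hmem : C j * MvPolynomial.map (algebraMap (𝓞 K) K) F ∈ mulInv F P := ⟨j, hj, rfl⟩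
        obtain ⟨G, hG⟩ := mulInv_subset_range hP hF hmem
        refine ⟨C x * G, ?_, ?_⟩
        · rw [sq]
          refine Ideal.mul_mem_mul (hp (Ideal.mem_map_of_mem _ hx)) (h ?_)
          rw [Set.mem_preimage, hG]
          exact hmem
        · rw [map_mul, hG, map_C, map_mul, mul_assoc]
      · rintro x y ⟨G₁, h₁, e₁⟩ ⟨G₂, h₂, e₂⟩
        exact ⟨G₁ + G₂, add_mem h₁ h₂, by rw [map_add, e₁, e₂, map_add, add_mul]⟩
    obtain ⟨G, hG, hGF⟩ := key 1 (by
      rw [FractionalIdeal.coe_ideal_mul_inv P hP]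
      exact FractionalIdeal.one_mem_one _)
    rw [map_one, one_mul] at hGF
    rwa [one_mul, ← map_injective (σ := Fin 2) (algebraMap (𝓞 K) K)
      (FaithfulSMul.algebraMap_injective _ _) hGF]

theorem primeFactor_le_iff {a b c : 𝓞 K} {F : MvPolynomial (Fin 2) (𝓞 K)} {P : Ideal (𝓞 K)}
    {M : Ideal (QuadricRing a b c)} :
    primeFactor a b c F P ≤ M ↔
      P.map C ≤ M.comap (Ideal.Quotient.mk (Ideal.span {quadricPoly a b c})) ∧
      MvPolynomial.map (algebraMap (𝓞 K) K) ⁻¹' mulInv F P ⊆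
        M.comap (Ideal.Quotient.mk (Ideal.span {quadricPoly a b c})) := by
  rw [primeFactor, sup_le_iff, Ideal.map_le_iff_le_comap, Ideal.map_le_iff_le_comap,
    Ideal.map_le_iff_le_comap, Ideal.span_le, Ideal.comap_comap]
  rfl

/-- The primes of `B[X,Y]` containing `g` that are singular on `g = 0` are those containing
`P` and `F_P P⁻¹` for some `P ∈ Γ`. -/
theorem exists_mul_quadricPoly_mem_sq_iff {a b c : 𝓞 K} {d e : Ideal (𝓞 K) → 𝓞 K}
    (hde : ∀ P ∈ Gam a b c, d P ^ 2 - a ∈ P ∧ e P ^ 2 - c ∈ P)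
    {p : Ideal (MvPolynomial (Fin 2) (𝓞 K))} [p.IsPrime] (hg : quadricPoly a b c ∈ p) :
    (∃ t ∉ p, t * quadricPoly a b c ∈ p ^ 2) ↔
      ∃ P ∈ Gam a b c, P.map C ≤ p ∧
        MvPolynomial.map (algebraMap (𝓞 K) K) ⁻¹' mulInv (FPoly a b c P (d P) (e P)) P ⊆ p := by
  have hpp : p.IsPrime := inferInstance
  have key {P : Ideal (𝓞 K)} (hP : P ∈ Gam a b c) (hcomap : p.comap C = P) :
      (∃ t ∉ p, t * quadricPoly a b c ∈ p ^ 2) ↔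
        MvPolynomial.map (algebraMap (𝓞 K) K) ⁻¹' mulInv (FPoly a b c P (d P) (e P)) P ⊆ p := by
    have : P.IsPrime := hP.1
    obtain ⟨hd, he⟩ := hde P hP
    rw [← exists_mul_mem_sq_iff (ne_bot_of_mem_Gam hP) (FPoly_mem_map_C hP hd he)
      (Ideal.map_le_iff_le_comap.mpr hcomap.ge)]
    obtain ⟨u, hu, hug⟩ := exists_mul_quadricPoly_sub_FPoly_mem_sq hP hd he hcomap hg
    constructor
    · rintro ⟨t, ht, h⟩
      refine ⟨t, ht, ?_⟩
      have := sub_mem (Ideal.mul_mem_left _ u h) (Ideal.mul_mem_left _ t hug)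
      convert this using 1
      ring
    · rintro ⟨t, ht, h⟩
      refine ⟨t * u, fun h' ↦ (hpp.mem_or_mem h').elim ht hu, ?_⟩
      have := add_mem (Ideal.mul_mem_left _ t hug) h
      convert this using 1
      ring
  constructor
  · rintro ⟨t, ht, h⟩
    have hP := comap_C_mem_Gam hg ht h
    exact ⟨p.comap C, hP, Ideal.map_comap_le, (key hP rfl).mp ⟨t, ht, h⟩⟩
  · rintro ⟨P, hP, hle, hF⟩
    have : P.IsPrime := hP.1
    have : P.IsMaximal := Ideal.IsPrime.isMaximal inferInstance (ne_bot_of_mem_Gam hP)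
    -- Nonzero primes of `B` are maximal, so `P ⊆ p ∩ B` is an equality.
    have hcomap : P = p.comap C := Ideal.IsMaximal.eq_of_le ‹_›
      (Ideal.IsPrime.ne_top inferInstance) (Ideal.map_le_iff_le_comap.mp hle)
    exact (key hP hcomap.symm).mpr hF

theorem singularLocus_quadricRing {a b c : 𝓞 K} {d e : Ideal (𝓞 K) → 𝓞 K}
    (hde : ∀ P ∈ Gam a b c, d P ^ 2 - a ∈ P ∧ e P ^ 2 - c ∈ P) :
    singularLocus (QuadricRing a b c) =
      PrimeSpectrum.zeroLocus (HIdeal a b c d e : Set (QuadricRing a b c)) := by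
  ext M
  have hg : quadricPoly a b c ∈
      M.asIdeal.comap (Ideal.Quotient.mk (Ideal.span {quadricPoly a b c})) := by
    rw [Ideal.mem_comap, Ideal.Quotient.eq_zero_iff_mem.mpr (Ideal.mem_span_singleton_self _)]
    exact zero_mem _
  rw [singularLocus, Set.mem_ofPred_eq,
    IsRegularRing.isRegularLocalRing_quotient_iff (Ideal.span {quadricPoly a b c}) M.asIdeal _ rfl
      (quadricPoly_ne_zero a b c) hg (by rw [Ideal.map_span, Set.image_singleton]),
    PrimeSpectrum.mem_zeroLocus, SetLike.coe_subset_coe, HIdeal, M.isPrime.prod_le]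
  push Not
  rw [exists_mul_quadricPoly_mem_sq_iff hde hg]
  simp only [primeFactor_le_iff, Set.Finite.mem_toFinset]

end RingOfIntegers

end Quadric

theorem theorem3 {K : Type*} [Field K] [NumberField K] (a b c : 𝓞 K) :
    (∀ P ∈ Quadric.Gam a b c, ∃ d e : 𝓞 K, d ^ 2 - a ∈ P ∧ e ^ 2 - c ∈ P) ∧
    ∀ d e : Ideal (𝓞 K) → 𝓞 K,
      (∀ P ∈ Quadric.Gam a b c, d P ^ 2 - a ∈ P ∧ e P ^ 2 - c ∈ P) →
      (∀ P ∈ Quadric.Gam a b c,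
        Quadric.mulInv (Quadric.FPoly a b c P (d P) (e P)) P ⊆
          Set.range (MvPolynomial.map (σ := Fin 2) (algebraMap (𝓞 K) K))) ∧
      Quadric.singularLocus (Quadric.QuadricRing a b c) =
        PrimeSpectrum.zeroLocus (Quadric.HIdeal a b c d e : Set (Quadric.QuadricRing a b c)) := by
  refine ⟨fun P hP ↦ ?_, fun d e hde ↦ ⟨fun P hP ↦ ?_, Quadric.singularLocus_quadricRing hde⟩⟩
  · have : P.IsPrime := hP.1
    have h (x : 𝓞 K) := Quadric.exists_sq_sub_mem (Quadric.ne_bot_of_mem_Gam hP)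
      (Quadric.two_mem_of_mem_Gam hP) x
    obtain ⟨d, hd⟩ := h a
    obtain ⟨e, he⟩ := h c
    exact ⟨d, e, hd, he⟩
  · exact Quadric.mulInv_subset_range (Quadric.ne_bot_of_mem_Gam hP)
      (Quadric.FPoly_mem_map_C hP (hde P hP).1 (hde P hP).2)
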